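/- For positive integers $n,k$ with $n\ge k+1$, let $J(n;k,k+1)$ be the doubled Johnson graph: its vertices are the $k$-subsets and the $(k+1)$-subsets of $[n]=\{1,\dots,n\}$, and two vertices $u,v$ are adjacent if and only if $u\subsetneq v$ or $v\subsetneq u$. Let $e(G)$ denote the number of edges of a finite graph $G$, let $C_m$ denote the cycle of length $m$, and let $\mathrm{ex}(G,H)$ denote the maximum number of edges in a subgraph of $G$ that contains no subgraph isomorphic to $H$. (i) For every integer $l\ge 2$ there exists a constant $c_l$, depending only on $l$, such that for all integers $k\ge 1$ and $n\ge 2k+1$, $$\mathrm{ex}\bigl(J(n;k,k+1),C_{4l}\bigr)\le\left(c_l\,(n-k)^{-\frac12+\frac1{2l}}+\frac1{\sqrt{k+1}}\right)e\bigl(J(n;k,k+1)\bigr).$$ (ii) For all integers $k\ge 1$ and $l\ge 1$ there exists a function $f=f_{k,l}:\mathbb N\to\mathbb R$ with $\lim_{n\to\infty}f(n)=0$ such that for every integer $n\ge 2k+1$, $$\mathrm{ex}\bigl(J(n;k,k+1),C_{4l+2}\bigr)\le\left(\frac1{2(k+1)}+\frac{\sqrt2}{2}+f(n)\right)e\bigl(J(n;k,k+1)\bigr).$$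 -/

import Mathlib

open Filter Topology

/-- The doubled Johnson graph `J(n;k,k+1)`: its vertices are the `k`-subsets and the
`(k+1)`-subsets of an `n`-element set, two of them being adjacent when one of them is strictly
contained in the other. -/
def doubledJohnson (n k : ℕ) :
    SimpleGraph {s : Finset (Fin n) // s.card = k ∨ s.card = k + 1} where
  Adj u v := u.1 ⊂ v.1 ∨ v.1 ⊂ u.1
  symm := ⟨fun _ _ h => h.symm⟩
  loopless := ⟨fun u h => h.elim (ssubset_irrefl u.1) (ssubset_irrefl u.1)⟩

/-- The number of edges `e(G)` of a (finite) graph. -/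
noncomputable def numEdges {V : Type*} (G : SimpleGraph V) : ℕ := G.edgeSet.ncard

/-- The generalized Turán number `ex(G, H)`: the maximum number of edges of a subgraph of `G`
that contains no (not necessarily induced) copy of `H`. -/
noncomputable def turanNumber {V W : Type*} (G : SimpleGraph V) (H : SimpleGraph W) : ℕ :=
  sSup {m : ℕ | ∃ G' : G.Subgraph, H.Free G'.coe ∧ numEdges G'.coe = m}

/-- For a finite graph `G` and a graph `H` with at least one vertex, the supremum that defines
`ex(G, H)` is a maximum. -/
theorem turanNumber_isGreatest {V W : Type*} [Finite V] [Nonempty W]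
    (G : SimpleGraph V) (H : SimpleGraph W) :
    IsGreatest {m : ℕ | ∃ G' : G.Subgraph, H.Free G'.coe ∧ numEdges G'.coe = m}
      (turanNumber G H) := by
  have hfin : {m : ℕ | ∃ G' : G.Subgraph, H.Free G'.coe ∧ numEdges G'.coe = m}.Finite := by
    refine (Set.finite_range (fun G' : G.Subgraph => numEdges G'.coe)).subset ?_
    rintro m ⟨G', -, h⟩
    exact ⟨G', h⟩
  have hne : {m : ℕ | ∃ G' : G.Subgraph, H.Free G'.coe ∧ numEdges G'.coe = m}.Nonempty := by
    refine ⟨_, ⊥, ?_, rfl⟩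
    rintro ⟨f⟩
    exact (f (Classical.arbitrary W)).2
  exact ⟨Nat.sSup_mem hne hfin.bddAbove, fun m hm => le_csSup hfin.bddAbove hm⟩

/-!
Let `K` be a subgraph of the doubled Johnson graph `J(n;k,k+1)` without a cycle of length `2 * m`.
For a set `A` of `k - 1` elements, the link of `A` is the graph on the ground set in which `x` and
`y` are adjacent when `A ∪ {x}`, `A ∪ {x, y}`, `A ∪ {y}` is a path of `K`. A cycle of length `m` in a
link gives a cycle of length `2 * m` in `K`, so that every link has at most `ex(n, C_m)` edges. An
edge of a link is the same as a pair of edges of `K` at a common `(k + 1)`-set `t`. If `δ` is the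
average degree of the `(k + 1)`-sets in `K`, then counting these pairs and the Cauchy–Schwarz
inequality give (`sq_density_le`)
`δ ^ 2 ≤ δ + 2 * ex(n, C_m) * k * (k + 1) / ((n - k + 1) * (n - k))`,
while `K` has the proportion `δ / (k + 1)` of the edges of `J(n;k,k+1)`.

For odd `m` the Erdős–Stone theorem bounds `ex(n, C_m)` by `(1 / 4 + o(1)) * n ^ 2`. Mathlib has it
in its minimum degree form, from which `turanDensity_le_half` follows by deleting vertices of minimum
degree.

For `m = 2 * l` one needs the Bondy–Simonovits theorem `ex(n, C_2l) = O(n ^ (1 + 1 / l))`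
(`extremalNumber_cycleGraph_two_mul_le`). A graph with many edges has a bipartite subgraph of large
minimum degree. If there is no cycle of length `2 * l`, then there are only linearly many edges
between consecutive levels of distance from a root, so that the levels grow too fast to fit in. The
reason is that many edges between two levels contain a cycle with a long chord
(`exists_cycle_with_long_chord`). In such a graph a set of vertices of one level that is closed under
paths of some fixed even length is trivial (`mem_iff_mem_add_two_of_chord`), which makes it possible
to find a path of precisely the length that the tree paths from its ends complete to a cycle of
length `2 * l` (`IsLevelling.cycleGraph_isContained`).
-/

/-! ### Cycles as sequences, and cycles with a chord -/

namespace SimpleGraph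

variable {V : Type*}

/-- The first `L + 1` terms of the sequence `p` are the vertices of a path of length `L` in `G`.
The later terms are irrelevant. -/
structure IsPathSeq (G : SimpleGraph V) (L : ℕ) (p : ℕ → V) : Prop where
  adj : ∀ i < L, G.Adj (p i) (p (i + 1))
  inj : ∀ i j, i ≤ L → j ≤ L → p i = p j → i = j

/-- A path of length `m - 1` whose ends are adjacent closes up to a copy of the cycle of length `m`. -/
theorem cycleGraph_isContained_of_seq {G : SimpleGraph V} {m : ℕ} {p : ℕ → V} (hm : 2 ≤ m)
    (hp : G.IsPathSeq (m - 1) p) (hclose : G.Adj (p (m - 1)) (p 0)) : cycleGraph m ⊑ G := by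
  refine ⟨⟨⟨fun i => p i, ?_⟩, ?_⟩⟩
  · suffices h : ∀ a b : Fin m, (a - b).val = 1 → G.Adj (p b) (p a) by
      intro a b hab
      rcases cycleGraph_adj'.mp hab with h1 | h1
      · exact (h a b h1).symm
      · exact h b a h1
    intro a b hab
    rcases le_or_gt b a with hle | hlt
    · rw [Fin.sub_val_of_le hle] at hab
      have : (a : ℕ) = b + 1 := by omega
      rw [this]
      exact hp.adj _ (by omega)
    · rw [Fin.coe_sub_iff_lt.mpr hlt] at hab
      have h1 : (a : ℕ) = 0 := by omega
      have h2 : (b : ℕ) = m - 1 := by omega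
      rw [h1, h2]
      exact hclose
  · intro a b hab
    exact Fin.ext (hp.inj a b (by omega) (by omega) hab)

theorem exists_seq_of_cycleGraph_isContained {G : SimpleGraph V} {m : ℕ} (hm : 2 ≤ m)
    (h : cycleGraph m ⊑ G) :
    ∃ p : ℕ → V, G.IsPathSeq (m - 1) p ∧ G.Adj (p (m - 1)) (p 0) := by
  obtain ⟨f⟩ := h
  refine ⟨fun i => f ⟨i % m, Nat.mod_lt _ (by omega)⟩, ⟨fun i hi => ?_, fun i j hi hj hij => ?_⟩, ?_⟩
  · refine f.toHom.map_adj (cycleGraph_adj'.mpr (Or.inr ?_))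
    rw [Fin.sub_val_of_le]
    · simp only []
      rw [Nat.mod_eq_of_lt (by omega), Nat.mod_eq_of_lt (by omega)]
      omega
    · rw [Fin.mk_le_mk, Nat.mod_eq_of_lt (by omega), Nat.mod_eq_of_lt (by omega)]
      omega
  · have := congrArg Fin.val (f.injective hij)
    simp only [] at this
    rwa [Nat.mod_eq_of_lt (by omega), Nat.mod_eq_of_lt (by omega)] at this
  · refine f.toHom.map_adj (cycleGraph_adj'.mpr (Or.inr ?_))
    have h1 : (⟨(m - 1) % m, Nat.mod_lt _ (by omega)⟩ : Fin m) = ⟨m - 1, by omega⟩ :=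
      Fin.ext (Nat.mod_eq_of_lt (by omega))
    have h2 : (⟨0 % m, Nat.mod_lt _ (by omega)⟩ : Fin m) = ⟨0, by omega⟩ := Fin.ext (by simp)
    rw [h1, h2, Fin.coe_sub_iff_lt.mpr (by rw [Fin.mk_lt_mk]; omega)]
    simp only []
    omega

/-- Let `c` run periodically around a cycle of length `n` that has a chord from `c 0` to `c r` with at
least `L` edges of the cycle on either side. If the two ends of every path of length `L` agree on
being in `A`, then membership in `A` is invariant under two steps along the cycle: the paths on the
cycle give the period `L`, and the paths through the chord give, modulo `L`, the periods `r - 1` and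
`r + 1`. -/
theorem mem_iff_mem_add_two_of_chord {G : SimpleGraph V} {A : Set V} {c : ℤ → V} {n r : ℤ} {L : ℕ}
    (hinj : ∀ x y, c x = c y → n ∣ x - y) (hadj : ∀ x, G.Adj (c x) (c (x + 1)))
    (hchord : G.Adj (c 0) (c r)) (hL : 0 < L) (hLr : L ≤ r) (hrn : r + L ≤ n)
    (hA : ∀ p, G.IsPathSeq L p → (p 0 ∈ A ↔ p L ∈ A)) (x : ℤ) : c x ∈ A ↔ c (x + 2) ∈ A := by
  have hinj' : ∀ x y, c x = c y → x - y < n → y - x < n → x = y := by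
    intro x y hxy h1 h2
    have := Int.eq_zero_of_abs_lt_dvd (hinj x y hxy) (abs_lt.mpr ⟨by omega, h1⟩)
    omega
  have hperL : Function.Periodic (fun x => c x ∈ A) (L : ℤ) := by
    intro x
    have := hA (fun j => c (x + j)) ⟨fun i _ => by simpa [add_assoc] using hadj (x + i),
      fun i j hi hj hij => by have := hinj' _ _ hij (by omega) (by omega); omega⟩
    simpa using this.symm
  have hshift : ∀ x : ℤ, ∃ s : ℕ, s < L ∧ ∃ q : ℤ, x = s + q * L := by
    intro x
    have h1 := Int.emod_nonneg x (b := L) (by omega)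
    have h2 := Int.emod_lt_of_pos x (b := L) (by omega)
    refine ⟨(x % L).toNat, by omega, x / L, ?_⟩
    have := Int.emod_add_mul_ediv x L
    rw [mul_comm]
    omega
  have hq : ∀ (x q : ℤ), (c (x + q * L) ∈ A) = (c x ∈ A) := fun x q => (hperL.int_mul q) x
  -- leave the cycle along the chord and go on in the same direction: period `r - 1`
  have hsame : ∀ x, c x ∈ A ↔ c (x + (r - 1)) ∈ A := by
    intro x
    obtain ⟨s, hs, q, hsq⟩ := hshift (-x)
    have hpath := hA (fun j => if j ≤ s then c ((j : ℤ) - s) else c (r + (j - s - 1)))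
      ⟨fun i hi => ?_, fun i j hi hj hij => ?_⟩
    · have e1 : x = ((0 : ℕ) : ℤ) - s + (-q) * L := by push_cast; linarith
      have e2 : x + (r - 1) = (r + (L - s - 1)) + (-q - 1) * L := by
        rw [e1]; push_cast; ring
      simp only [zero_le, if_true, if_neg (not_le.mpr hs)] at hpath
      rw [e2, hq, e1, hq]
      exact hpath
    · rcases lt_trichotomy i s with h | h | h
      · simp only [if_pos h.le, if_pos (Nat.succ_le_of_lt h)]
        convert hadj ((i : ℤ) - s) using 2
        push_cast; ring
      · subst h
        simpa using hchord
      · simp only [if_neg (not_le.mpr h), if_neg (show ¬ i + 1 ≤ s by omega)]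
        convert hadj (r + ((i : ℤ) - s - 1)) using 2
        push_cast; ring
    · split_ifs at hij with h1 h2 h2 <;>
        (have := hinj' _ _ hij (by omega) (by omega); omega)
  -- leave the cycle along the chord and turn around: period `r + 1`
  have hturn : ∀ x, c x ∈ A ↔ c (x + (r + 1)) ∈ A := by
    intro x
    obtain ⟨s, hs, q, hsq⟩ := hshift x
    have hpath := hA (fun j => if j ≤ s then c ((s : ℤ) - j) else c (r - (j - s - 1)))
      ⟨fun i hi => ?_, fun i j hi hj hij => ?_⟩
    · have e2 : x + (r + 1) = (r - (L - s - 1)) + (q + 1) * L := by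
        rw [hsq]; ring
      simp only [zero_le, if_true, if_neg (not_le.mpr hs)] at hpath
      rw [e2, hq, hsq, hq]
      simpa using hpath
    · rcases lt_trichotomy i s with h | h | h
      · simp only [if_pos h.le, if_pos (Nat.succ_le_of_lt h)]
        convert (hadj ((s : ℤ) - i - 1)).symm using 2
        · ring
        · push_cast; ring
      · subst h
        simpa using hchord
      · simp only [if_neg (not_le.mpr h), if_neg (show ¬ i + 1 ≤ s by omega)]
        convert (hadj (r - ((i : ℤ) - s - 1) - 1)).symm using 2
        · ring
        · push_cast; ring
    · split_ifs at hij with h1 h2 h2 <;>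
        (have := hinj' _ _ hij (by omega) (by omega); omega)
  have h1 := hsame (x - (r - 1))
  have h2 := hturn (x - (r - 1))
  rw [show x - (r - 1) + (r - 1) = x by ring] at h1
  rw [show x - (r - 1) + (r + 1) = x + 2 by ring] at h2
  rw [← h1, h2]

/-- Minimum degree more than `2 * L` inside `S` forces a cycle in `S`, listed periodically by `c` with
period `n`, and a chord with at least `L` edges of the cycle on either side. All neighbours of an
end of a longest path lie on that path; the last of them closes the cycle, and one of those in the
middle gives the chord. -/
theorem exists_cycle_with_long_chord [DecidableEq V] {G : SimpleGraph V} [DecidableRel G.Adj]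
    {S : Finset V} (hS : S.Nonempty) {L : ℕ} (hL : 0 < L)
    (hdeg : ∀ v ∈ S, 2 * L < (S.filter (G.Adj v)).card) :
    ∃ (c : ℤ → V) (n r : ℤ), (∀ x, c x ∈ S) ∧ (∀ x y, c x = c y → n ∣ x - y) ∧
      (∀ x, G.Adj (c x) (c (x + 1))) ∧ G.Adj (c 0) (c r) ∧ L ≤ r ∧ r + L ≤ n := by
  classical
  let P : ℕ → Prop := fun N => ∃ p, G.IsPathSeq N p ∧ ∀ i ≤ N, p i ∈ S
  have hbound : ∀ N, P N → N ≤ S.card := by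
    rintro N ⟨p, hp, hpS⟩
    have : (Finset.range (N + 1)).card ≤ S.card :=
      Finset.card_le_card_of_injOn p (fun i hi => hpS i (by simpa using! hi))
        (fun i hi j hj hij => hp.inj i j (by simpa using! hi) (by simpa using! hj) hij)
    rw [Finset.card_range] at this
    omega
  obtain ⟨v0, hv0⟩ := hS
  have hP0 : P 0 := ⟨fun _ => v0, ⟨by simp, by intros; omega⟩, fun _ _ => hv0⟩
  obtain ⟨p, hp, hpS⟩ : P (Nat.findGreatest P S.card) :=
    Nat.findGreatest_spec (m := 0) (Nat.zero_le _) hP0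
  set N := Nat.findGreatest P S.card with hN
  have hmax : ¬ P (N + 1) := fun h => by
    have := Nat.le_findGreatest (hbound _ h) h
    omega
  let I := (Finset.range (N + 1)).filter (fun i => G.Adj (p 0) (p i))
  have hI : 2 * L < I.card := by
    refine (hdeg (p 0) (hpS 0 (Nat.zero_le _))).trans_le ((Finset.card_le_card ?_).trans
      (Finset.card_image_le (f := p)))
    intro w hw
    rw [Finset.mem_filter] at hw
    -- a neighbour off the path would prolong it
    by_contra hnot
    have hoff : ∀ i ≤ N, p i ≠ w := fun i hi h => hnot (Finset.mem_image.mpr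
      ⟨i, Finset.mem_filter.mpr ⟨Finset.mem_range.mpr (by omega), h ▸ hw.2⟩, h⟩)
    refine hmax ⟨fun j => if j = 0 then w else p (j - 1), ⟨fun i hi => ?_, fun i j hi hj hij => ?_⟩,
      fun i hi => ?_⟩
    · rcases Nat.eq_zero_or_pos i with rfl | h
      · simpa using hw.2.symm
      · have := hp.adj (i - 1) (by omega)
        simpa [h.ne', Nat.sub_add_cancel h] using this
    · split_ifs at hij with h1 h2 h2
      · omega
      · exact absurd hij.symm (hoff _ (by omega))
      · exact absurd hij (hoff _ (by omega))
      · have := hp.inj _ _ (by omega) (by omega) hij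
        omega
    · dsimp only
      split_ifs
      · exact hw.1
      · exact hpS _ (by omega)
  have hIne : I.Nonempty := Finset.card_pos.mp (by omega)
  set M := I.max' hIne with hM
  have hMI : M ∈ I := I.max'_mem hIne
  obtain ⟨r, hrI, hLr, hrM⟩ : ∃ r ∈ I, L ≤ r ∧ r + L ≤ M + 1 := by
    by_contra hcon
    push Not at hcon
    have hsub : I ⊆ Finset.range L ∪ Finset.Ioc (M - L) M := by
      intro s hs
      have h1 := hcon s hs
      have h2 : s ≤ M := I.le_max' s hs
      rw [Finset.mem_union, Finset.mem_range, Finset.mem_Ioc]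
      omega
    have := (Finset.card_le_card hsub).trans (Finset.card_union_le _ _)
    rw [Finset.card_range, Nat.card_Ioc] at this
    omega
  have hMI' := Finset.mem_filter.mp hMI
  have hrI' := Finset.mem_filter.mp hrI
  have hMN : M ≤ N := by have := Finset.mem_range.mp hMI'.1; omega
  have hmod : ∀ x : ℤ, 0 ≤ x % ((M : ℤ) + 1) ∧ x % ((M : ℤ) + 1) < M + 1 := fun x =>
    ⟨Int.emod_nonneg _ (by omega), Int.emod_lt_of_pos _ (by omega)⟩
  refine ⟨fun x => p (x % ((M : ℤ) + 1)).toNat, (M : ℤ) + 1, r, fun x => ?_, fun x y hxy => ?_,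
    fun x => ?_, ?_, by omega, by omega⟩
  · have := hmod x
    exact hpS _ (by omega)
  · have h1 := hmod x
    have h2 := hmod y
    have := hp.inj _ _ (by omega) (by omega) hxy
    exact Int.ModEq.dvd (show y ≡ x [ZMOD _] by unfold Int.ModEq; omega)
  · have h1 := hmod x
    rcases eq_or_ne (x % ((M : ℤ) + 1)) M with h | h
    · have h2 : (x + 1) % ((M : ℤ) + 1) = 0 := by
        rw [Int.add_emod_eq_add_emod_right 1 (show x % ((M : ℤ) + 1) = (M : ℤ) % (M + 1) by
          rw [h, Int.emod_eq_of_lt (by omega) (by omega)])]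
        simp
      simp only [h, h2]
      simpa using hMI'.2.symm
    · have h2 : (x + 1) % ((M : ℤ) + 1) = x % ((M : ℤ) + 1) + 1 := by
        rw [← Int.emod_add_emod, Int.emod_eq_of_lt (by omega) (by omega)]
      simp only [h2, Int.toNat_add h1.1 zero_le_one]
      exact hp.adj _ (by omega)
  · have : (r : ℤ) % ((M : ℤ) + 1) = r := Int.emod_eq_of_lt (by omega) (by omega)
    simp only [this]
    simpa using hrI'.2

/-- A path `p` of length `L` from level `i` to level `i`, running in levels at least `i`, together with
the tree paths going up from its two ends, which meet for the first time after `m` steps, is a cycle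
of length `L + 2 * m`. -/
theorem cycleGraph_isContained_of_tree_paths {G : SimpleGraph V} {lev : V → ℕ} {par : V → V}
    {l i m : ℕ} {p : ℕ → V}
    (hlev : ∀ v, lev v ≤ i → ∀ s ≤ lev v, lev (par^[s] v) = lev v - s)
    (hpar : ∀ v, lev v ≤ i → ∀ s < lev v, G.Adj (par^[s] v) (par^[s + 1] v))
    (hm : 0 < m) (hmi : m ≤ i) (hil : i < l) (hLm : L + 2 * m = 2 * l) (hp : G.IsPathSeq (L) p)
    (hple : ∀ j ≤ L, i ≤ lev (p j))
    (h0 : lev (p 0) = i) (hL : lev (p (L)) = i)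
    (hmeet : par^[m] (p 0) = par^[m] (p (L)))
    (hne : ∀ s < m, par^[s] (p 0) ≠ par^[s] (p (L))) : cycleGraph (2 * l) ⊑ G := by
  have hla : ∀ s ≤ i, lev (par^[s] (p 0)) = i - s := fun s hs => by
    rw [hlev _ h0.le s (by omega), h0]
  have hlb : ∀ s ≤ i, lev (par^[s] (p L)) = i - s := fun s hs => by
    rw [hlev _ hL.le s (by omega), hL]
  let q : ℕ → V := fun j =>
    if j ≤ L then p j else if j ≤ L + m then par^[j - L] (p L) else par^[2 * l - j] (p 0)
  have q1 : ∀ j, j ≤ L → q j = p j := fun j h => if_pos h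
  have q2 : ∀ j, L ≤ j → j ≤ L + m → q j = par^[j - L] (p L) := by
    intro j h1 h2
    rcases h1.eq_or_lt with rfl | h
    · simp [q]
    · simp [q, not_le.mpr h, h2]
  have q3 : ∀ j, L + m ≤ j → q j = par^[2 * l - j] (p 0) := by
    intro j h
    rcases h.eq_or_lt with rfl | h
    · rw [q2 _ (by omega) le_rfl, show L + m - L = m by omega, show 2 * l - (L + m) = m by omega,
        hmeet]
    · simp [q, not_le.mpr h, show ¬ j ≤ L by omega]
  refine cycleGraph_isContained_of_seq (p := q) (by omega)
    ⟨fun j hj => ?_, fun j j' hj hj' hjj => ?_⟩ ?_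
  · rcases lt_or_ge j L with h | h
    · rw [q1 _ h.le, q1 _ h]
      exact hp.adj j h
    rcases lt_or_ge j (L + m) with h' | h'
    · rw [q2 _ h h'.le, q2 _ (by omega) h', show j + 1 - L = j - L + 1 by omega]
      exact hpar _ hL.le _ (by omega)
    · rw [q3 _ h', q3 _ (by omega), show 2 * l - j = 2 * l - (j + 1) + 1 by omega]
      exact (hpar _ h0.le _ (by omega)).symm
  · wlog hle : j ≤ j' generalizing j j'
    · exact (this j' j hj' hj hjj.symm (by omega)).symm
    rcases le_or_gt j' L with h' | h'
    · rw [q1 _ h', q1 _ (hle.trans h')] at hjj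
      exact hp.inj _ _ (by omega) h' hjj
    have hlevj' : lev (q j') < i := by
      rcases le_or_gt j' (L + m) with h'' | h''
      · rw [q2 _ h'.le h'', hlb _ (by omega)]
        omega
      · rw [q3 _ h''.le, hla _ (by omega)]
        omega
    rcases le_or_gt j L with h | h
    · have := hple j h
      rw [← q1 _ h, hjj] at this
      omega
    have hlevs := congrArg lev hjj
    rcases le_or_gt j' (L + m) with h'' | h''
    · rw [q2 _ h.le (by omega), q2 _ h'.le h'', hlb _ (by omega), hlb _ (by omega)] at hlevs
      omega
    rcases le_or_gt j (L + m) with hj'' | hj''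
    · rw [q2 _ h.le hj'', q3 _ h''.le, hlb _ (by omega), hla _ (by omega)] at hlevs
      rw [q2 _ h.le hj'', q3 _ h''.le, show j - L = 2 * l - j' by omega] at hjj
      exact absurd hjj.symm (hne _ (by omega))
    · rw [q3 _ hj''.le, q3 _ h''.le, hla _ (by omega), hla _ (by omega)] at hlevs
      omega
  · rw [q3 _ (by omega), q1 _ (Nat.zero_le _), show 2 * l - (2 * l - 1) = 0 + 1 by omega]
    exact (hpar _ h0.le 0 (by omega)).symm

/-! ### Levels and even cycles -/

/-- `lev` behaves up to level `l` like the distance from `r` in a bipartite graph: `r` is the only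
vertex of level `0`, a vertex of positive level at most `l` has a neighbour one level below, and
edges at a level less than or equal to `l` join consecutive levels. Vertices out of reach may have
any level above `l`. -/
structure IsLevelling (G : SimpleGraph V) (r : V) (l : ℕ) (lev : V → ℕ) : Prop where
  root : ∀ v, lev v = 0 ↔ v = r
  down : ∀ v, 0 < lev v → lev v ≤ l → ∃ u, G.Adj v u ∧ lev u + 1 = lev v
  step : ∀ u v, G.Adj u v → lev u ≤ l → lev v = lev u + 1 ∨ lev v + 1 = lev u

/-- The bipartite graph of the edges of `G` between the levels `i` and `i + 1`. -/
def betweenLevels (G : SimpleGraph V) (lev : V → ℕ) (i : ℕ) : SimpleGraph V where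
  Adj u v := G.Adj u v ∧ (lev u = i ∧ lev v = i + 1 ∨ lev u = i + 1 ∧ lev v = i)
  symm := ⟨fun _ _ h => ⟨h.1.symm, h.2.symm.imp And.symm And.symm⟩⟩
  loopless := ⟨fun _ h => G.irrefl h.1⟩

/-- If the edges between two consecutive levels below `l` contain a subgraph of minimum degree more
than `4 * l`, then there is a cycle of length `2 * l`. That subgraph contains a cycle with a long
chord. Going up the tree from the cycle vertices of the upper level, all ancestors agree for the
first time after some number `m` of steps. The set `A` of those that have a common ancestor after
`m - 1` steps is neither empty nor everything, so by `mem_iff_mem_add_two_of_chord` some path of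
length `2 * l - 2 * m` leads from `A` out of `A`, and the tree paths complete it to a cycle. -/
theorem IsLevelling.cycleGraph_isContained [DecidableEq V] {G : SimpleGraph V} {r : V} {l : ℕ}
    {lev : V → ℕ} (h : G.IsLevelling r l lev) {i : ℕ} (hil : i < l)
    [DecidableRel (G.betweenLevels lev i).Adj] {S : Finset V} (hS : S.Nonempty)
    (hdeg : ∀ v ∈ S, 4 * l < (S.filter ((G.betweenLevels lev i).Adj v)).card) :
    cycleGraph (2 * l) ⊑ G := by
  classical
  obtain ⟨c, n, t, -, hinj, hadj, hchord, hlt, htn⟩ :=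
    exists_cycle_with_long_chord (G := G.betweenLevels lev i) hS (L := 2 * l) (by omega)
      (fun v hv => by have := hdeg v hv; omega)
  have hn : 4 ≤ n := by omega
  have hpar : ∀ v, ∃ u, 0 < lev v → lev v ≤ l → G.Adj v u ∧ lev u + 1 = lev v := by
    intro v
    by_cases hv : 0 < lev v ∧ lev v ≤ l
    · obtain ⟨u, hu⟩ := h.down v hv.1 hv.2
      exact ⟨u, fun _ _ => hu⟩
    · exact ⟨v, fun h1 h2 => absurd ⟨h1, h2⟩ hv⟩
  choose par hpar using hpar
  have hlevpar : ∀ v, lev v ≤ i → ∀ s ≤ lev v, lev (par^[s] v) = lev v - s := by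
    intro v hv s
    induction s with
    | zero => intro _; simp
    | succ s ih =>
      intro hs
      rw [Function.iterate_succ_apply']
      have h1 := ih (by omega)
      have h2 := (hpar (par^[s] v) (by omega) (by omega)).2
      omega
  have hadjpar : ∀ v, lev v ≤ i → ∀ s < lev v, G.Adj (par^[s] v) (par^[s + 1] v) := by
    intro v hv s hs
    rw [Function.iterate_succ_apply']
    have h1 := hlevpar v hv s hs.le
    exact (hpar (par^[s] v) (by omega) (by omega)).1
  -- the cycle alternates between the two levels
  have halt : ∀ x, lev (c x) = i ↔ lev (c (x + 1)) = i + 1 := by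
    intro x
    have := (hadj x).2
    omega
  have halt' : ∀ x, lev (c x) = i ∨ lev (c x) = i + 1 := fun x => by
    have := (hadj x).2
    omega
  have heven : ∀ x (k : ℕ), lev (c (x + 2 * k)) = lev (c x) := by
    intro x k
    induction k with
    | zero => simp
    | succ k ih =>
      have h1 := (hadj (x + 2 * k)).2
      have h2 := (hadj (x + 2 * k + 1)).2
      rw [show x + 2 * ((k + 1 : ℕ) : ℤ) = x + 2 * k + 1 + 1 by push_cast; ring]
      omega
  have hroot : ∀ x y, lev (c x) = i → lev (c y) = i → par^[i] (c x) = par^[i] (c y) := by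
    intro x y hx hy
    have h1 := hlevpar (c x) hx.le i hx.ge
    have h2 := hlevpar (c y) hy.le i hy.ge
    rw [(h.root (par^[i] (c x))).mp (by omega), (h.root (par^[i] (c y))).mp (by omega)]
  let P : ℕ → Prop := fun s =>
    ∀ x y, lev (c x) = i → lev (c y) = i → par^[s] (c x) = par^[s] (c y)
  have hPi : ∃ s, P s := ⟨i, hroot⟩
  have hP0 : ¬ P 0 := by
    intro h0
    obtain ⟨x, hx⟩ : ∃ x, lev (c x) = i := by
      rcases halt' 0 with h1 | h1
      · exact ⟨0, h1⟩
      · refine ⟨0 + 1, ?_⟩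
        have := (hadj 0).2
        omega
    have h1 := hinj _ _ (h0 (x + 2) x (by simpa using (heven x 1).trans hx) hx)
    have := Int.le_of_dvd (by omega) h1
    omega
  -- `m` is the height at which the tree paths from the cycle first come together
  obtain ⟨m, hm, hmin⟩ : ∃ m, P m ∧ ∀ s < m, ¬ P s :=
    ⟨Nat.find hPi, Nat.find_spec hPi, fun s hs => Nat.find_min hPi hs⟩
  have hm0 : 0 < m := Nat.pos_of_ne_zero (fun h0 => hP0 (h0 ▸ hm))
  have hmi : m ≤ i := by
    by_contra hlt'
    exact hmin i (by omega) hroot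
  have hPm := hmin (m - 1) (by omega)
  simp only [P, not_forall] at hPm
  obtain ⟨x0, y0, hx0, hy0, hxy⟩ := hPm
  let A : Set V := {v | lev v = i ∧ par^[m - 1] v = par^[m - 1] (c x0)}
  let H : SimpleGraph V := (G.betweenLevels lev i) ⊓
    { Adj := fun u v => u ≠ v ∧ u ∈ Set.range c ∧ v ∈ Set.range c
      symm := ⟨fun _ _ h => ⟨h.1.symm, h.2.2, h.2.1⟩⟩
      loopless := ⟨fun _ h => h.1 rfl⟩ }
  have hHadj : ∀ x y, (G.betweenLevels lev i).Adj (c x) (c y) → H.Adj (c x) (c y) :=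
    fun x y hxy => ⟨hxy, hxy.ne, ⟨x, rfl⟩, ⟨y, rfl⟩⟩
  obtain ⟨p, hp, hpA⟩ : ∃ p, H.IsPathSeq (2 * l - 2 * m) p ∧
      ¬ (p 0 ∈ A ↔ p (2 * l - 2 * m) ∈ A) := by
    by_contra hcon
    push Not at hcon
    have hstep := mem_iff_mem_add_two_of_chord (A := A) hinj (fun x => hHadj _ _ (hadj x))
      (hHadj _ _ hchord) (L := 2 * l - 2 * m) (r := t) (n := n) (by omega)
      (by omega) (by omega) (fun p hp => hcon p hp)
    have hmul : ∀ (k : ℕ) x, c x ∈ A ↔ c (x + 2 * k) ∈ A := by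
      intro k
      induction k with
      | zero => simp
      | succ k ih =>
        intro x
        rw [ih, hstep, show x + 2 * (k : ℤ) + 2 = x + 2 * ((k + 1 : ℕ) : ℤ) by push_cast; ring]
    have hx0A : c x0 ∈ A := ⟨hx0, rfl⟩
    have hy0A : c y0 ∉ A := fun hA => hxy hA.2.symm
    have hodd : ∀ x y (k : ℕ), lev (c x) = i → lev (c y) = i → y ≠ x + 2 * k + 1 := by
      rintro x y k hx hy rfl
      have := (halt (x + 2 * k)).mp ((heven x k).trans hx)
      omega
    rcases le_total x0 y0 with hle | hle
    · rcases Int.even_or_odd' (y0 - x0) with ⟨k, hk | hk⟩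
      · have := (hmul k.toNat x0).mp hx0A
        rw [show x0 + 2 * (k.toNat : ℤ) = y0 by omega] at this
        exact hy0A this
      · exact hodd x0 y0 k.toNat hx0 hy0 (by omega)
    · rcases Int.even_or_odd' (x0 - y0) with ⟨k, hk | hk⟩
      · refine hy0A ((hmul k.toNat y0).mpr ?_)
        rwa [show y0 + 2 * (k.toNat : ℤ) = x0 by omega]
      · exact hodd y0 x0 k.toNat hy0 hx0 (by omega)
  have hplev : ∀ j ≤ 2 * l - 2 * m, i ≤ lev (p j) ∧
      (Even j → lev (p j) = lev (p 0)) ∧ p j ∈ Set.range c := by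
    intro j
    induction j using Nat.strong_induction_on with
    | _ j ih =>
      intro hj
      rcases j with _ | j
      · have h1 := hp.adj 0 (by omega)
        have := h1.1.2
        exact ⟨by omega, fun _ => rfl, h1.2.2.1⟩
      · have h1 := hp.adj j (by omega)
        have h2 := h1.1.2
        refine ⟨by omega, fun he => ?_, h1.2.2.2⟩
        rcases j with _ | j
        · exact absurd he (by decide)
        · have h3 := (hp.adj j (by omega)).1.2
          have h4 := (ih j (by omega) (by omega)).2.1 (by
            rw [Nat.even_iff] at he ⊢; omega)
          omega
  have hLlev := (hplev (2 * l - 2 * m) le_rfl).2.1 (by rw [Nat.even_iff]; omega)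
  have h0i : lev (p 0) = i := by
    by_contra hne
    exact hpA ⟨fun hA => absurd hA.1 hne, fun hA => absurd (hLlev ▸ hA.1) hne⟩
  obtain ⟨xa, hxa⟩ := (hplev 0 (by omega)).2.2
  obtain ⟨xb, hxb⟩ := (hplev (2 * l - 2 * m) le_rfl).2.2
  refine cycleGraph_isContained_of_tree_paths hlevpar hadjpar hm0 hmi hil
    (L := 2 * l - 2 * m) (p := p) (by omega) ⟨fun j hj => (hp.adj j hj).1.1, hp.inj⟩
    (fun j hj => (hplev j hj).1) h0i (hLlev.trans h0i) ?_ ?_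
  · rw [← hxa, ← hxb]
    exact hm xa xb (hxa ▸ h0i) (by rw [hxb]; exact hLlev.trans h0i)
  · intro s hs heq
    have : par^[m - 1] (p 0) = par^[m - 1] (p (2 * l - 2 * m)) := by
      rw [show m - 1 = (m - 1 - s) + s by omega, Function.iterate_add_apply, heq,
        ← Function.iterate_add_apply]
    refine hpA ⟨fun hA => ⟨hLlev.trans h0i, this ▸ hA.2⟩, fun hA => ⟨h0i, this.trans hA.2⟩⟩

theorem exists_isLevelling {G : SimpleGraph V} (χ : G.Coloring Bool) (r : V) (l : ℕ) :
    ∃ lev, G.IsLevelling r l lev := by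
  classical
  refine ⟨fun v => if G.Reachable r v then G.dist r v else l + 1, fun v => ?_, fun v h0 hl => ?_,
    fun u v huv hu => ?_⟩
  · by_cases hv : G.Reachable r v
    · rw [if_pos hv, hv.dist_eq_zero_iff, eq_comm]
    · rw [if_neg hv]
      exact ⟨fun h => by omega, fun h => absurd (h ▸ Reachable.refl _) hv⟩
  · by_cases hv : G.Reachable r v
    · rw [if_pos hv] at h0 ⊢
      obtain ⟨w, hw⟩ := hv.exists_walk_length_eq_dist
      have hnil : ¬ w.Nil := by
        rw [← Walk.length_eq_zero_iff]
        omega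
      refine ⟨w.penultimate, (w.adj_penultimate hnil).symm, ?_⟩
      have hr : G.Reachable r w.penultimate := ⟨w.dropLast⟩
      rw [if_pos hr]
      have h1 := dist_le w.dropLast
      have h2 : w.dropLast.length = w.length - 1 := by simp
      have h3 := (w.adj_penultimate hnil).diff_dist_adj (u := r)
      omega
    · rw [if_neg hv] at hl
      omega
  · by_cases hur : G.Reachable r u
    · have hvr : G.Reachable r v := hur.trans huv.reachable
      rw [if_pos hur, if_pos hvr]
      obtain ⟨w, hw⟩ := hur.exists_walk_length_eq_dist
      obtain ⟨w', hw'⟩ := hvr.exists_walk_length_eq_dist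
      have h1 := χ.even_length_iff_congr w
      have h2 := χ.even_length_iff_congr w'
      have h3 := χ.valid huv
      have h4 := huv.diff_dist_adj (u := r)
      rw [hw] at h1
      rw [hw'] at h2
      have h5 : G.dist r v ≠ G.dist r u := by
        intro heq
        rw [heq, h1] at h2
        revert h2 h3
        cases χ r <;> cases χ u <;> cases χ v <;> simp
      omega
    · rw [if_neg hur] at hu
      omega

/-! ### The Bondy–Simonovits theorem -/

/-- Average degree more than `2 * D` yields a nonempty set with minimum degree more than `D`: delete
vertices of degree at most `D` as long as there are any. -/
theorem exists_subset_lt_degree [DecidableEq V] (G : SimpleGraph V) [DecidableRel G.Adj] (D : ℕ)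
    (S : Finset V) (h : 2 * D * S.card < ∑ v ∈ S, (S.filter (G.Adj v)).card) :
    ∃ T ⊆ S, T.Nonempty ∧ ∀ v ∈ T, D < (T.filter (G.Adj v)).card := by
  induction S using Finset.strongInduction with
  | H S ih =>
    by_cases hall : ∀ v ∈ S, D < (S.filter (G.Adj v)).card
    · refine ⟨S, subset_rfl, Finset.nonempty_iff_ne_empty.mpr ?_, hall⟩
      rintro rfl
      simp at h
    push Not at hall
    obtain ⟨v, hv, hvD⟩ := hall
    suffices hlt : 2 * D * (S.erase v).card <
        ∑ u ∈ S.erase v, ((S.erase v).filter (G.Adj u)).card by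
      obtain ⟨T, hT, h1, h2⟩ := ih _ (Finset.erase_ssubset hv) hlt
      exact ⟨T, hT.trans (Finset.erase_subset _ _), h1, h2⟩
    have h1 : ∑ u ∈ S.erase v, (S.filter (G.Adj u)).card ≤
        ∑ u ∈ S.erase v, (((S.erase v).filter (G.Adj u)).card + if G.Adj v u then 1 else 0) := by
      refine Finset.sum_le_sum fun u _ => ?_
      split_ifs with huv
      · rw [Finset.filter_erase]
        exact Nat.sub_le_iff_le_add.mp Finset.pred_card_le_card_erase
      · refine Finset.card_le_card fun w hw => ?_
        rw [Finset.mem_filter] at hw ⊢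
        exact ⟨Finset.mem_erase.mpr ⟨fun hwv => huv (hwv ▸ hw.2.symm), hw.1⟩, hw.2⟩
    have h2 : ∑ u ∈ S.erase v, (if G.Adj v u then 1 else 0) ≤ (S.filter (G.Adj v)).card := by
      rw [← Finset.card_filter]
      exact Finset.card_le_card (Finset.filter_subset_filter _ (Finset.erase_subset _ _))
    rw [Finset.sum_add_distrib] at h1
    rw [← Finset.add_sum_erase _ _ hv, ← Finset.card_erase_add_one hv, mul_add] at h
    omega

/-- Some 2-colouring of the vertices makes at least half of the edges bichromatic, since a random one
does so on average. -/
theorem exists_two_colouring_half_le [Fintype V] [DecidableEq V] (G : SimpleGraph V)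
    [DecidableRel G.Adj] :
    ∃ f : V → Bool, ∑ v, (Finset.univ.filter (G.Adj v)).card ≤
      2 * ∑ v, (Finset.univ.filter (fun w => G.Adj v w ∧ f v ≠ f w)).card := by
  have hhalf : ∀ a b : V, a ≠ b →
      2 * (Finset.univ.filter (fun f : V → Bool => f a ≠ f b)).card = Fintype.card (V → Bool) := by
    intro a b hab
    have h1 := Finset.card_filter_add_card_filter_not (s := (Finset.univ : Finset (V → Bool)))
      (fun f => f a ≠ f b)
    -- flipping the colour of `a` exchanges the two kinds of colourings
    have h2 : (Finset.univ.filter (fun f : V → Bool => f a ≠ f b)).card =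
        (Finset.univ.filter (fun f : V → Bool => ¬ f a ≠ f b)).card := by
      refine Finset.card_bij' (fun f _ => Function.update f a (!f a))
        (fun f _ => Function.update f a (!f a)) ?_ ?_ ?_ ?_
      · intro f hf
        have := (Finset.mem_filter.mp hf).2
        simp only [Finset.mem_filter, Finset.mem_univ, true_and, Function.update_self,
          Function.update_of_ne hab.symm]
        revert this
        cases f a <;> cases f b <;> simp
      · intro f hf
        have := (Finset.mem_filter.mp hf).2
        simp only [Finset.mem_filter, Finset.mem_univ, true_and, Function.update_self,
          Function.update_of_ne hab.symm]
        revert this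
        cases f a <;> cases f b <;> simp
      · intro f _; simp
      · intro f _; simp
    rw [Finset.card_univ] at h1
    omega
  have hsum : ∑ f : V → Bool,
      2 * ∑ v, (Finset.univ.filter (fun w => G.Adj v w ∧ f v ≠ f w)).card =
      ∑ f : V → Bool, ∑ v, (Finset.univ.filter (G.Adj v)).card := by
    simp_rw [Finset.mul_sum]
    rw [Finset.sum_comm, Finset.sum_comm (f := fun (_ : V → Bool) v => _)]
    refine Finset.sum_congr rfl fun v _ => ?_
    have hcount := Finset.sum_card_bipartiteAbove_eq_sum_card_bipartiteBelow
      (s := (Finset.univ : Finset (V → Bool))) (t := Finset.univ.filter (G.Adj v))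
      (fun f w => f v ≠ f w)
    simp only [Finset.bipartiteAbove, Finset.bipartiteBelow, Finset.filter_filter] at hcount
    rw [← Finset.mul_sum, hcount, Finset.mul_sum, Finset.sum_const, Finset.card_univ,
      smul_eq_mul, mul_comm, ← smul_eq_mul, ← Finset.sum_const]
    exact Finset.sum_congr rfl fun w hw => hhalf v w (Finset.mem_filter.mp hw).2.ne
  by_contra hcon
  push Not at hcon
  exact absurd hsum (Finset.sum_lt_sum_of_nonempty Finset.univ_nonempty fun f _ => hcon f).ne

/-- Without a cycle of length `2 * l` there are only linearly many edges between consecutive levels,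
which are counted here once from either side. -/
theorem IsLevelling.sum_degree_between_le [Fintype V] [DecidableEq V] {G : SimpleGraph V}
    [DecidableRel G.Adj] {r : V} {l : ℕ} {lev : V → ℕ} (h : G.IsLevelling r l lev)
    (hfree : (cycleGraph (2 * l)).Free G) {i : ℕ} (hil : i < l) :
    ∑ v with lev v = i, (Finset.univ.filter (fun w => G.Adj v w ∧ lev w = i + 1)).card +
      ∑ v with lev v = i + 1, (Finset.univ.filter (fun w => G.Adj v w ∧ lev w = i)).card ≤
    8 * l * ((Finset.univ.filter (lev · = i)).card +
      (Finset.univ.filter (lev · = i + 1)).card) := by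
  classical
  have hdisj : Disjoint (Finset.univ.filter (lev · = i)) (Finset.univ.filter (lev · = i + 1)) := by
    rw [Finset.disjoint_filter]
    omega
  by_contra! hlt
  rw [← Finset.card_union_of_disjoint hdisj] at hlt
  set S := Finset.univ.filter (lev · = i) ∪ Finset.univ.filter (lev · = i + 1) with hS
  obtain ⟨T, -, hTne, hT⟩ := exists_subset_lt_degree (G.betweenLevels lev i) (4 * l) S <| by
    rw [hS, Finset.sum_union hdisj, ← hS]
    refine (lt_of_eq_of_lt (by ring) hlt).trans_le (add_le_add ?_ ?_)
    all_goals
      refine Finset.sum_le_sum fun v hv => Finset.card_le_card fun w hw => ?_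
      simp only [Finset.mem_filter, Finset.mem_univ, true_and, hS, Finset.mem_union,
        betweenLevels] at hv hw ⊢
      exact ⟨by tauto, by tauto⟩
  exact hfree (h.cycleGraph_isContained hil hTne hT)

/-- Without a cycle of length `2 * l`, the first `l` levels grow by a factor `K` each if all degrees
are at least `8 * l * (K + 3)`. -/
theorem IsLevelling.pow_le_card [Fintype V] [DecidableEq V] {G : SimpleGraph V}
    [DecidableRel G.Adj] {r : V} {l K : ℕ} {lev : V → ℕ} (h : G.IsLevelling r l lev)
    (hfree : (cycleGraph (2 * l)).Free G) (hl : 0 < l) (hK : 0 < K)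
    (hdeg : ∀ v, lev v ≤ l → 8 * l * (K + 3) ≤ (Finset.univ.filter (G.Adj v)).card) :
    K ^ l ≤ Fintype.card V := by
  let N : ℕ → ℕ := fun i => (Finset.univ.filter (lev · = i)).card
  have hN0 : N 0 = 1 := by
    rw [Finset.card_eq_one]
    exact ⟨r, by ext v; simp [h.root]⟩
  have hgrow : ∀ i < l, K * N i ≤ N (i + 1) := by
    intro i
    induction i with
    | zero =>
      intro _
      rw [hN0, mul_one]
      have hr : lev r = 0 := (h.root r).mpr rfl
      refine le_trans ?_ ((hdeg r (by omega)).trans (Finset.card_le_card fun v hv => ?_))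
      · nlinarith
      · rw [Finset.mem_filter] at hv ⊢
        have := h.step r v hv.2 (by omega)
        exact ⟨hv.1, by omega⟩
    | succ i ih =>
      intro hi
      have h1 := ih (by omega)
      have h2 := h.sum_degree_between_le hfree (show i < l by omega)
      have h3 := h.sum_degree_between_le hfree hi
      have h4 : 8 * l * (K + 3) * N (i + 1) ≤
          ∑ v with lev v = i + 1, ((Finset.univ.filter (fun w => G.Adj v w ∧ lev w = i)).card +
            (Finset.univ.filter (fun w => G.Adj v w ∧ lev w = i + 1 + 1)).card) := by
        rw [mul_comm, ← smul_eq_mul, ← Finset.sum_const]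
        refine Finset.sum_le_sum fun v hv => ?_
        rw [Finset.mem_filter] at hv
        refine (hdeg v (by omega)).trans (le_trans (Finset.card_le_card fun w hw => ?_)
          (Finset.card_union_le _ _))
        have hw' := (Finset.mem_filter.mp hw).2
        have := h.step v w hw' (by omega)
        simp only [Finset.mem_union, Finset.mem_filter, Finset.mem_univ, true_and, hw']
        omega
      rw [Finset.sum_add_distrib] at h4
      have h5 : 8 * l * ((K + 3) * N (i + 1)) ≤
          8 * l * (N i + 2 * N (i + 1) + N (i + 1 + 1)) := by
        have : 8 * l * (N i + 2 * N (i + 1) + N (i + 1 + 1)) =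
          8 * l * (N i + N (i + 1)) + 8 * l * (N (i + 1) + N (i + 1 + 1)) := by ring
        rw [this, ← mul_assoc]
        simp only [N] at h4 ⊢
        omega
      have h6 := Nat.le_of_mul_le_mul_left h5 (by omega)
      have h7 : N i ≤ N (i + 1) := (Nat.le_mul_of_pos_left _ hK).trans h1
      linarith [add_mul K 3 (N (i + 1))]
  have hpow : ∀ i ≤ l, K ^ i ≤ N i := by
    intro i
    induction i with
    | zero => intro _; simp [hN0]
    | succ i ih =>
      intro hi
      rw [pow_succ']
      exact (Nat.mul_le_mul_left _ (ih (by omega))).trans (hgrow i (by omega))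
  exact (hpow l le_rfl).trans (Finset.card_le_univ _)

theorem sum_degree_le_of_cycleGraph_free [Fintype V] [DecidableEq V] {G : SimpleGraph V}
    [DecidableRel G.Adj] {l K : ℕ} (hl : 0 < l) (hfree : (cycleGraph (2 * l)).Free G)
    (hK : Fintype.card V < K ^ l) :
    ∑ v, (Finset.univ.filter (G.Adj v)).card ≤ 32 * l * (K + 3) * Fintype.card V := by
  classical
  by_contra! hlt
  obtain ⟨f, hf⟩ := G.exists_two_colouring_half_le
  let B : SimpleGraph V :=
    { Adj := fun u v => G.Adj u v ∧ f u ≠ f v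
      symm := ⟨fun _ _ h => ⟨h.1.symm, h.2.symm⟩⟩
      loopless := ⟨fun _ h => h.2 rfl⟩ }
  obtain ⟨S, -, ⟨r, hr⟩, hS⟩ := exists_subset_lt_degree B (8 * l * (K + 3)) Finset.univ (by
    have : ∑ v, (Finset.univ.filter (B.Adj v)).card =
      ∑ v, (Finset.univ.filter (fun w => G.Adj v w ∧ f v ≠ f w)).card := by simp only [B]
    rw [Finset.card_univ, this]
    nlinarith)
  let C : SimpleGraph V :=
    { Adj := fun u v => B.Adj u v ∧ u ∈ S ∧ v ∈ S
      symm := ⟨fun _ _ h => ⟨h.1.symm, h.2.2, h.2.1⟩⟩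
      loopless := ⟨fun _ h => B.irrefl h.1⟩ }
  have hCG : C ≤ G := fun u v h => h.1.1
  obtain ⟨lev, hlev⟩ := exists_isLevelling (G := C) ⟨f, fun h => h.1.2⟩ r l
  have hK0 : 0 < K := Nat.pos_of_ne_zero fun h0 => by
    rw [h0, zero_pow hl.ne'] at hK
    omega
  refine absurd (hlev.pow_le_card (fun hc => hfree (hc.mono_right hCG)) hl hK0 fun v hv => ?_)
    (not_le.mpr hK)
  have hvS : v ∈ S := by
    rcases Nat.eq_zero_or_pos (lev v) with h0 | h0
    · rwa [(hlev.root v).mp h0]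
    · obtain ⟨u, hu, -⟩ := hlev.down v h0 hv
      exact hu.2.1
  refine (hS v hvS).le.trans (Finset.card_le_card fun w hw => ?_)
  rw [Finset.mem_filter] at hw
  exact Finset.mem_filter.mpr ⟨Finset.mem_univ _, hw.2, hvS, hw.1⟩

/-- The **Bondy–Simonovits theorem** on even cycles. -/
theorem extremalNumber_cycleGraph_two_mul_le {l : ℕ} (hl : 0 < l) (n : ℕ) :
    (extremalNumber n (cycleGraph (2 * l)) : ℝ) ≤ 80 * l * (n : ℝ) ^ (1 + 1 / (l : ℝ)) := by
  classical
  have hl' : (0 : ℝ) < l := by exact_mod_cast hl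
  conv_lhs => rw [← Fintype.card_fin n]
  rw [extremalNumber_le_iff_of_nonneg _ (by positivity)]
  intro G _ hfree
  rcases Nat.eq_zero_or_pos n with rfl | hn
  · have : G.edgeFinset.card = 0 := by
      rw [Finset.card_eq_zero]
      ext e
      induction e with | _ a b => exact a.elim0
    rw [this, Nat.cast_zero]
    positivity
  have hn1 : (1 : ℝ) ≤ n := by exact_mod_cast hn
  set x : ℝ := (n : ℝ) ^ (1 / (l : ℝ)) with hx
  have hx1 : 1 ≤ x := Real.one_le_rpow hn1 (by positivity)
  have hxl : x ^ l = n := by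
    rw [hx, one_div, Real.rpow_inv_natCast_pow (by positivity) hl.ne']
  have hsum := sum_degree_le_of_cycleGraph_free (K := ⌊x⌋₊ + 1) hl hfree (by
    rw [Fintype.card_fin]
    have : (n : ℝ) < (((⌊x⌋₊ + 1) ^ l : ℕ) : ℝ) := by
      rw [← hxl]
      push_cast
      exact pow_lt_pow_left₀ (Nat.lt_floor_add_one x) (by positivity) hl.ne'
    exact_mod_cast this)
  have hedges : ∑ v, (Finset.univ.filter (G.Adj v)).card = 2 * G.edgeFinset.card := by
    rw [← G.sum_degrees_eq_twice_card_edges]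
    refine Finset.sum_congr rfl fun v _ => ?_
    rw [← G.card_neighborFinset_eq_degree, G.neighborFinset_eq_filter]
  rw [hedges, Fintype.card_fin] at hsum
  have hsum' : (2 : ℝ) * G.edgeFinset.card ≤ 32 * l * (⌊x⌋₊ + 1 + 3) * n := by exact_mod_cast hsum
  have hfl : (⌊x⌋₊ : ℝ) ≤ x := Nat.floor_le (by linarith)
  rw [Real.rpow_add (by linarith), Real.rpow_one, ← hx]
  have h1 : (32 * l * (⌊x⌋₊ + 1 + 3) * n : ℝ) ≤ 32 * l * (5 * x) * n := by
    gcongr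
    linarith
  nlinarith

/-! ### Extremal numbers of graphs of chromatic number three -/

theorem cycleGraph_odd_isContained_completeEquipartiteGraph {l : ℕ} (hl : 1 ≤ l) :
    cycleGraph (2 * l + 1) ⊑ completeEquipartiteGraph 3 l := by
  refine cycleGraph_isContained_of_seq (p := fun j => if h : j < 2 * l then
    ((⟨j % 2, by omega⟩ : Fin 3), (⟨j / 2, by omega⟩ : Fin l)) else (2, ⟨0, by omega⟩))
    (by omega) ⟨fun i hi => ?_, fun i j hi hj hij => ?_⟩ ?_
  · rw [completeEquipartiteGraph_adj]
    rw [dif_pos (by omega)]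
    split_ifs with h
    · simp only [ne_eq, Fin.mk.injEq]
      omega
    · intro h'
      have := congrArg Fin.val h'
      simp only [Fin.val_two] at this
      omega
  · split_ifs at hij with h1 h2 h2
    · simp only [Prod.mk.injEq, Fin.mk.injEq] at hij
      omega
    · have := congrArg (fun x => x.1.val) hij
      simp only [Fin.val_two] at this
      omega
    · have := congrArg (fun x => x.1.val) hij
      simp only [Fin.val_two] at this
      omega
    · omega
  · rw [completeEquipartiteGraph_adj, dif_neg (by omega), dif_pos (by omega)]
    intro h'
    have := congrArg Fin.val h'
    simp at this

/-- Deletion of a vertex of minimum degree from an extremal graph, in which that degree is bounded by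
the minimum degree form of the Erdős–Stone theorem. -/
theorem eventually_extremalNumber_succ_le {W : Type*} {H : SimpleGraph W} {t : ℕ}
    (hH : H ⊑ completeEquipartiteGraph 3 t) (hbot : H ≠ ⊥) {ε : ℝ} (hε : 0 < ε) :
    ∀ᶠ n : ℕ in atTop, (extremalNumber (n + 1) H : ℝ) ≤
      extremalNumber n H + (1 / 2 + ε) * ((n : ℝ) + 1) := by
  have h := eventually_completeEquipartiteGraph_isContained_of_minDegree hε 2 t
  filter_upwards [(tendsto_add_atTop_nat 1).eventually h] with n hn
  classical
  obtain ⟨G, hdec, hG⟩ := exists_isExtremal_free (V := Fin (n + 1)) hbot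
  have hcard := card_edgeFinset_of_isExtremal_free hG
  rw [Fintype.card_fin] at hcard
  have hmin : (G.minDegree : ℝ) < (1 / 2 + ε) * ((n : ℝ) + 1) := by
    by_contra! hle
    refine hG.prop (hH.trans (hn ?_))
    push_cast
    linarith
  obtain ⟨v, hv⟩ := G.exists_minimal_degree_vertex
  have hdel := card_edgeFinset_deleteIncidenceSet_le_extremalNumber hG.prop v
  rw [card_edgeFinset_deleteIncidenceSet, Fintype.card_fin, Nat.add_sub_cancel, hcard, ← hv] at hdel
  have : (extremalNumber (n + 1) H : ℝ) ≤ extremalNumber n H + G.minDegree := by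
    exact_mod_cast (show extremalNumber (n + 1) H ≤ extremalNumber n H + G.minDegree by omega)
  linarith

theorem tendsto_natCast_div_sub (a b : ℝ) :
    Tendsto (fun n : ℕ => ((n : ℝ) + a) / ((n : ℝ) + b)) atTop (𝓝 1) := by
  have h : Tendsto (fun n : ℕ => 1 + (a - b) / ((n : ℝ) + b)) atTop (𝓝 (1 + 0)) :=
    tendsto_const_nhds.add ((tendsto_atTop_add_const_right _ b
      tendsto_natCast_atTop_atTop).const_div_atTop _)
  rw [add_zero] at h
  refine h.congr' ?_
  filter_upwards [(tendsto_atTop_add_const_right _ b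
      (tendsto_natCast_atTop_atTop (R := ℝ))).eventually_gt_atTop 0] with n hn
  field_simp
  ring

theorem turanDensity_le_half {W : Type*} {H : SimpleGraph W} {t : ℕ}
    (hH : H ⊑ completeEquipartiteGraph 3 t) (hbot : H ≠ ⊥) : turanDensity H ≤ 1 / 2 := by
  refine le_of_forall_pos_le_add fun ε hε => ?_
  obtain ⟨N, hN⟩ := eventually_atTop.mp (eventually_extremalNumber_succ_le hH hbot hε)
  have hbound : ∀ n ≥ N, (extremalNumber n H : ℝ) ≤
      extremalNumber N H + (1 / 2 + ε) * ((n : ℝ) * (n + 1) / 2) := by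
    intro n hn
    induction n, hn using Nat.le_induction with
    | base =>
      have : 0 ≤ (1 / 2 + ε) * ((N : ℝ) * (N + 1) / 2) := by positivity
      linarith
    | succ n hn ih =>
      have := hN n hn
      push_cast
      have e : (1 / 2 + ε) * (((n : ℝ) + 1) * (n + 1 + 1) / 2) =
        (1 / 2 + ε) * ((n : ℝ) * (n + 1) / 2) + (1 / 2 + ε) * ((n : ℝ) + 1) := by ring
      rw [e]
      linarith
  have hlim : Tendsto (fun n : ℕ => (extremalNumber N H : ℝ) / (n.choose 2 : ℝ) +
      (1 / 2 + ε) * (((n : ℝ) + 1) / ((n : ℝ) + (-1)))) atTop (𝓝 (0 + (1 / 2 + ε) * 1)) := by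
    refine Tendsto.add ?_ ((tendsto_natCast_div_sub 1 (-1)).const_mul _)
    refine Tendsto.const_div_atTop ?_ _
    refine tendsto_natCast_atTop_atTop.comp (tendsto_atTop_mono' _ ?_ (tendsto_sub_atTop_nat 1))
    filter_upwards [eventually_ge_atTop 2] with n hn
    have : 2 * (n - 1) ≤ n * (n - 1) := Nat.mul_le_mul_right _ hn
    rw [Nat.choose_two_right]
    omega
  rw [zero_add, mul_one] at hlim
  refine le_of_tendsto_of_tendsto (tendsto_turanDensity H) hlim ?_
  filter_upwards [eventually_ge_atTop N, eventually_ge_atTop 2] with n hn hn2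
  have hn2' : (2 : ℝ) ≤ n := by exact_mod_cast hn2
  have hch : (n.choose 2 : ℝ) = n * (n - 1) / 2 := Nat.cast_choose_two ℝ n
  have h2 : (0 : ℝ) < n - 1 := by linarith
  have h1 : (1 / 2 + ε) * (((n : ℝ) + 1) / ((n : ℝ) + (-1))) =
      (1 / 2 + ε) * ((n : ℝ) * (n + 1) / 2) / (n.choose 2 : ℝ) := by
    rw [hch, ← sub_eq_add_neg]
    field_simp
  rw [h1, ← add_div]
  exact div_le_div_of_nonneg_right (hbound n hn) (by positivity)

/-! ### Links in the doubled Johnson graph -/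

theorem Subgraph.isContained_coe_of_spanningCoe {V W : Type*} {G : SimpleGraph V}
    {G' : G.Subgraph} {H : SimpleGraph W} (hH : ∀ w, ∃ w', H.Adj w w')
    (h : H ⊑ G'.spanningCoe) : H ⊑ G'.coe := by
  obtain ⟨f⟩ := h
  have hadj : ∀ w w', H.Adj w w' → G'.Adj (f w) (f w') := fun w w' h => f.toHom.map_adj h
  refine ⟨⟨⟨fun w => ⟨f w, (hadj _ _ (hH w).choose_spec).fst_mem⟩, fun {w w'} h => hadj w w' h⟩,
    fun w w' h => f.injective (congrArg Subtype.val h)⟩⟩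

theorem exists_cycleGraph_adj {n : ℕ} (hn : 2 ≤ n) (v : Fin n) : ∃ w, (cycleGraph n).Adj v w := by
  obtain ⟨n, rfl⟩ : ∃ m, n = m + 2 := ⟨n - 2, by omega⟩
  exact ⟨v + 1, by rw [cycleGraph_adj]; simp⟩

end SimpleGraph

open SimpleGraph

theorem numEdges_spanningCoe {V : Type*} {G : SimpleGraph V} (G' : G.Subgraph) :
    numEdges G'.spanningCoe = numEdges G'.coe := by
  unfold numEdges
  rw [← Set.ncard_image_of_injective G'.coe.edgeSet (Sym2.map.injective Subtype.val_injective)]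
  congr 1
  ext e
  induction e with | _ a b =>
  simp only [Set.mem_image, mem_edgeSet, Subgraph.spanningCoe_adj]
  constructor
  · intro h
    exact ⟨s(⟨a, h.fst_mem⟩, ⟨b, h.snd_mem⟩), h, rfl⟩
  · rintro ⟨e, he, h⟩
    induction e with | _ x y =>
    have hxy : G'.Adj x y := he
    rw [Sym2.map_mk, Sym2.eq_iff] at h
    rcases h with ⟨h1, h2⟩ | ⟨h1, h2⟩
    · exact h1 ▸ h2 ▸ hxy
    · exact h1 ▸ h2 ▸ hxy.symm

section DoubledJohnson

variable {n k : ℕ}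

/-- Adjacency in a graph on the vertices of the doubled Johnson graph, as a relation between
arbitrary sets that fails outside the two layers. -/
def LayerAdj (K : SimpleGraph {s : Finset (Fin n) // s.card = k ∨ s.card = k + 1})
    (s t : Finset (Fin n)) : Prop :=
  ∃ hs ht, K.Adj ⟨s, hs⟩ ⟨t, ht⟩

/-- The link of a set `A` in a subgraph `K` of the doubled Johnson graph: `x` and `y` outside `A`
are adjacent when `A ∪ {x}`, `A ∪ {x, y}`, `A ∪ {y}` is a path in `K`. -/
def linkGraph (K : SimpleGraph {s : Finset (Fin n) // s.card = k ∨ s.card = k + 1})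
    (A : Finset (Fin n)) : SimpleGraph (Fin n) where
  Adj x y := x ≠ y ∧ x ∉ A ∧ y ∉ A ∧ LayerAdj K (insert x A) (insert x (insert y A)) ∧
    LayerAdj K (insert y A) (insert x (insert y A))
  symm := ⟨fun x y h => ⟨h.1.symm, h.2.2.1, h.2.1, by
    rw [Finset.insert_comm y x]; exact ⟨h.2.2.2.2, h.2.2.2.1⟩⟩⟩
  loopless := ⟨fun _ h => h.1 rfl⟩

/-- A cycle `x₀ x₁ …` in the link of `A` gives the cycle `A ∪ {x₀}`, `A ∪ {x₀, x₁}`, `A ∪ {x₁}`, … of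
twice the length. -/
theorem cycleGraph_isContained_of_linkGraph
    {K : SimpleGraph {s : Finset (Fin n) // s.card = k ∨ s.card = k + 1}} {A : Finset (Fin n)}
    {m : ℕ} (hm : 3 ≤ m) (h : cycleGraph m ⊑ linkGraph K A) : cycleGraph (2 * m) ⊑ K := by
  obtain ⟨c, hc, hclose⟩ := exists_seq_of_cycleGraph_isContained (by omega) h
  obtain ⟨u, hu⟩ : ∃ u : ℕ → Fin n, ∀ i, u i = c (i % m) := ⟨_, fun _ => rfl⟩
  have hmod : ∀ i, i % m < m := fun i => Nat.mod_lt _ (by omega)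
  have huadj : ∀ i, (linkGraph K A).Adj (u i) (u (i + 1)) := by
    intro i
    rw [hu, hu, Nat.add_mod, Nat.mod_eq_of_lt (show 1 < m by omega)]
    have := hmod i
    rcases eq_or_ne (i % m) (m - 1) with h1 | h1
    · rw [h1, Nat.sub_add_cancel (by omega), Nat.mod_self]
      exact hclose
    · rw [Nat.mod_eq_of_lt (a := i % m + 1) (by omega)]
      exact hc.adj _ (by omega)
  have huinj : ∀ i j, u i = u j → i % m = j % m := fun i j hij => by
    rw [hu, hu] at hij
    have h1 := hmod i
    have h2 := hmod j
    exact hc.inj _ _ (by omega) (by omega) hij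
  have huA : ∀ i, u i ∉ A := fun i => (huadj i).2.1
  let s : ℕ → Finset (Fin n) := fun j =>
    if j % 2 = 0 then insert (u (j / 2)) A else insert (u (j / 2)) (insert (u (j / 2 + 1)) A)
  have s0 : ∀ i, s (2 * i) = insert (u i) A := fun i => by simp [s]
  have s1 : ∀ i, s (2 * i + 1) = insert (u i) (insert (u (i + 1)) A) := fun i => by
    simp [s, Nat.add_mod, show (2 * i + 1) / 2 = i by omega]
  have hsadj : ∀ j, LayerAdj K (s j) (s (j + 1)) := by
    intro j
    rcases Nat.even_or_odd' j with ⟨i, rfl | rfl⟩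
    · rw [s0, s1]
      exact (huadj i).2.2.2.1
    · rw [s1, show 2 * i + 1 + 1 = 2 * (i + 1) by ring, s0]
      obtain ⟨h1, h2, h3⟩ := (huadj i).2.2.2.2
      exact ⟨h2, h1, h3.symm⟩
  have hsmem : ∀ j, (s j).card = k ∨ (s j).card = k + 1 := fun j => (hsadj j).choose
  have hsm : s (2 * m) = s 0 := by
    have := s0 0
    rw [mul_zero] at this
    rw [s0, this, hu, hu, Nat.mod_self, Nat.zero_mod]
  refine cycleGraph_isContained_of_seq (p := fun j => ⟨s j, hsmem j⟩) (by omega)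
    ⟨fun i _ => ?_, fun i j hi hj hij => ?_⟩ ?_
  · obtain ⟨_, _, h⟩ := hsadj i
    exact h
  · have hs : s i = s j := congrArg Subtype.val hij
    have hcard0 : ∀ a, (s (2 * a)).card = A.card + 1 := fun a => by
      rw [s0, Finset.card_insert_of_notMem (huA a)]
    have hcard1 : ∀ a, (s (2 * a + 1)).card = A.card + 2 := fun a => by
      rw [s1, Finset.card_insert_of_notMem, Finset.card_insert_of_notMem (huA _)]
      rw [Finset.mem_insert, not_or]
      exact ⟨(huadj a).ne, huA a⟩
    rcases Nat.even_or_odd' i with ⟨a, rfl | rfl⟩ <;> rcases Nat.even_or_odd' j with ⟨b, rfl | rfl⟩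
    · rw [s0, s0] at hs
      have h1 : u a ∈ insert (u b) A := hs ▸ Finset.mem_insert_self _ _
      have h2 := huinj _ _ ((Finset.mem_insert.mp h1).resolve_right (huA a))
      rw [Nat.mod_eq_of_lt (by omega), Nat.mod_eq_of_lt (by omega)] at h2
      rw [h2]
    · have := congrArg Finset.card hs
      rw [hcard0, hcard1] at this
      omega
    · have := congrArg Finset.card hs
      rw [hcard0, hcard1] at this
      omega
    · rw [s1, s1] at hs
      have hmem : ∀ d, u d ∈ insert (u a) (insert (u (a + 1)) A) →
          d % m = b % m ∨ d % m = (b + 1) % m := by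
        intro d hd
        rw [hs, Finset.mem_insert, Finset.mem_insert] at hd
        rcases hd with h1 | h1 | h1
        · exact Or.inl (huinj _ _ h1)
        · exact Or.inr (huinj _ _ h1)
        · exact absurd h1 (huA d)
      have h1 := hmem a (by simp)
      have h2 := hmem (a + 1) (by simp)
      have hsucc : ∀ d < m, (d + 1) % m = if d + 1 = m then 0 else d + 1 := by
        intro d hd
        split_ifs with h'
        · rw [h', Nat.mod_self]
        · exact Nat.mod_eq_of_lt (by omega)
      rw [hsucc a (by omega), hsucc b (by omega), Nat.mod_eq_of_lt (show b < m by omega)] at h2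
      rw [hsucc b (by omega), Nat.mod_eq_of_lt (show b < m by omega),
        Nat.mod_eq_of_lt (show a < m by omega)] at h1
      split_ifs at h1 h2 <;> (try rw [or_false] at h2) <;> omega
  · obtain ⟨_, _, h⟩ := hsadj (2 * m - 1)
    simp only [show 2 * m - 1 + 1 = 2 * m by omega, hsm] at h
    exact h

open Classical in
/-- The elements `x` of `t` for which `K` joins `t` to `t \ {x}`. -/
noncomputable def removable
    (K : SimpleGraph {s : Finset (Fin n) // s.card = k ∨ s.card = k + 1})
    (t : Finset (Fin n)) : Finset (Fin n) :=
  t.filter (fun x => LayerAdj K (t.erase x) t)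

theorem numEdges_eq_sum_card_removable
    {K : SimpleGraph {s : Finset (Fin n) // s.card = k ∨ s.card = k + 1}}
    (hK : K ≤ doubledJohnson n k) :
    numEdges K = ∑ t ∈ Finset.powersetCard (k + 1) Finset.univ, (removable K t).card := by
  classical
  have hadj : ∀ u v, K.Adj u v → u.1.card = k ∧ v.1.card = k + 1 ∧ u.1 ⊂ v.1 ∨
      v.1.card = k ∧ u.1.card = k + 1 ∧ v.1 ⊂ u.1 := by
    intro u v huv
    rcases hK huv with h | h
    · have := Finset.card_lt_card h
      have h1 := u.2
      have h2 := v.2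
      exact Or.inl ⟨by omega, by omega, h⟩
    · have := Finset.card_lt_card h
      have h1 := u.2
      have h2 := v.2
      exact Or.inr ⟨by omega, by omega, h⟩
  unfold numEdges
  rw [Set.ncard_eq_toFinset_card', ← Finset.card_sigma]
  symm
  refine Finset.card_bij (fun q hq => s(⟨q.1.erase q.2, ?_⟩, ⟨q.1, ?_⟩)) ?_ ?_ ?_
  · rw [Finset.mem_sigma, removable, Finset.mem_filter] at hq
    exact hq.2.2.choose
  · rw [Finset.mem_sigma, removable, Finset.mem_filter] at hq
    exact hq.2.2.choose_spec.choose
  · intro q hq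
    rw [Finset.mem_sigma, removable, Finset.mem_filter] at hq
    obtain ⟨_, _, h⟩ := hq.2.2
    rw [Set.mem_toFinset]
    exact h
  · rintro ⟨t, x⟩ hq ⟨t', x'⟩ hq' h
    rw [Finset.mem_sigma, removable, Finset.mem_filter, Finset.mem_powersetCard] at hq hq'
    rw [Sym2.eq_iff] at h
    rcases h with ⟨h1, h2⟩ | ⟨h1, h2⟩
    · have h2 : t = t' := congrArg Subtype.val h2
      subst h2
      have h1 : t.erase x = t.erase x' := congrArg Subtype.val h1
      rw [show x = x' from (Finset.erase_inj _ hq.2.1).mp h1]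
    · have h1 : t.erase x = t' := congrArg Subtype.val h1
      have h2 := congrArg Finset.card h1
      rw [Finset.card_erase_of_mem hq.2.1] at h2
      have h3 := hq.1.2
      have h4 := hq'.1.2
      simp only at h2 h3 h4
      omega
  · intro e he
    rw [Set.mem_toFinset] at he
    induction e with | _ u v =>
    wlog huv : u.1.card = k ∧ v.1.card = k + 1 ∧ u.1 ⊂ v.1 generalizing u v
    · obtain ⟨q, hq, h⟩ := this v u he.symm (by have := hadj u v he; tauto)
      exact ⟨q, hq, h.trans Sym2.eq_swap⟩
    obtain ⟨hu, hv, huv⟩ := huv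
    obtain ⟨x, hx, hxu⟩ := Finset.exists_of_ssubset huv
    have hux : v.1.erase x = u.1 := by
      refine (Finset.eq_of_subset_of_card_le (Finset.subset_erase.mpr ⟨huv.1, hxu⟩) ?_).symm
      rw [Finset.card_erase_of_mem hx]
      omega
    refine ⟨⟨v.1, x⟩, ?_, ?_⟩
    · rw [Finset.mem_sigma, removable, Finset.mem_filter, Finset.mem_powersetCard]
      refine ⟨⟨Finset.subset_univ _, hv⟩, hx, ?_⟩
      simp only [hux]
      exact ⟨u.2, v.2, he⟩
    · simp only [hux]

theorem numEdges_doubledJohnson (n k : ℕ) :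
    numEdges (doubledJohnson n k) = (k + 1) * n.choose (k + 1) := by
  rw [numEdges_eq_sum_card_removable le_rfl]
  have h : ∀ t ∈ Finset.powersetCard (k + 1) (Finset.univ : Finset (Fin n)),
      (removable (doubledJohnson n k) t).card = k + 1 := by
    classical
    intro t ht
    rw [Finset.mem_powersetCard] at ht
    rw [removable, Finset.filter_true_of_mem, ht.2]
    intro x hx
    exact ⟨Or.inl (by rw [Finset.card_erase_of_mem hx]; omega), Or.inr ht.2,
      Or.inl (Finset.erase_ssubset hx)⟩
  rw [Finset.sum_congr rfl h, Finset.sum_const, Finset.card_powersetCard, Finset.card_univ,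
    Fintype.card_fin, smul_eq_mul, mul_comm]

/-- A pair `x ≠ y` of removable elements of `t` is an edge of the link of `t \ {x, y}`, and links
contain no cycle of length `m`. -/
theorem sum_card_offDiag_removable_le
    {K : SimpleGraph {s : Finset (Fin n) // s.card = k ∨ s.card = k + 1}} (hk : 1 ≤ k) {m : ℕ}
    (hm : 3 ≤ m) (hfree : (cycleGraph (2 * m)).Free K) :
    ∑ t ∈ Finset.powersetCard (k + 1) Finset.univ, (removable K t).offDiag.card ≤
      n.choose (k - 1) * (2 * extremalNumber n (cycleGraph m)) := by
  classical
  have hlink : ∀ A, (Finset.univ.filter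
      (fun q : Fin n × Fin n => (linkGraph K A).Adj q.1 q.2)).card ≤
        2 * extremalNumber n (cycleGraph m) := by
    intro A
    have h1 := card_edgeFinset_le_extremalNumber (G := linkGraph K A) (H := cycleGraph m)
      fun h => hfree (cycleGraph_isContained_of_linkGraph hm h)
    rw [Fintype.card_fin] at h1
    have h2 := (linkGraph K A).sum_degrees_eq_twice_card_edges
    rw [← dart_card_eq_sum_degrees] at h2
    refine le_trans (Finset.card_le_card_of_surjOn (s := Finset.univ)
      (fun d : (linkGraph K A).Dart => d.toProd) fun q hq => ?_) (?_ : _ ≤ _)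
    · simp only [Finset.coe_filter, Finset.mem_univ, true_and, Set.mem_ofPred_eq] at hq
      exact ⟨⟨q, hq⟩, by simp, rfl⟩
    · rw [Finset.card_univ]
      omega
  rw [← Finset.card_sigma]
  refine le_trans (Finset.card_le_card_of_injOn
    (t := (Finset.powersetCard (k - 1) Finset.univ).sigma fun A => Finset.univ.filter
      (fun q : Fin n × Fin n => (linkGraph K A).Adj q.1 q.2))
    (fun q => ⟨(q.1.erase q.2.1).erase q.2.2, q.2⟩) ?_ ?_) ?_
  · rintro ⟨t, x, y⟩ hq
    simp only [Finset.coe_sigma, Set.mem_sigma_iff, Finset.mem_coe, Finset.mem_powersetCard,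
      Finset.mem_offDiag, removable, Finset.mem_filter, Finset.mem_univ, true_and,
      Finset.subset_univ] at hq ⊢
    obtain ⟨ht, ⟨hx, hxK⟩, ⟨hy, hyK⟩, hxy⟩ := hq
    have hyx : y ∈ t.erase x := Finset.mem_erase.mpr ⟨hxy.symm, hy⟩
    have hxy' : x ∈ t.erase y := Finset.mem_erase.mpr ⟨hxy, hx⟩
    have h1 : insert y ((t.erase x).erase y) = t.erase x := Finset.insert_erase hyx
    have h2 : insert x ((t.erase x).erase y) = t.erase y := by
      rw [Finset.erase_right_comm, Finset.insert_erase hxy']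
    refine ⟨?_, hxy, by simp, by simp, ?_⟩
    · rw [Finset.card_erase_of_mem hyx, Finset.card_erase_of_mem hx]
      omega
    · rw [h1, h2, Finset.insert_erase hx]
      exact ⟨hyK, hxK⟩
  · rintro ⟨t, x, y⟩ hq ⟨t', x', y'⟩ hq' h
    simp only [Finset.coe_sigma, Set.mem_sigma_iff, Finset.mem_coe, Finset.mem_offDiag,
      removable, Finset.mem_filter] at hq hq'
    simp only [Sigma.mk.injEq, heq_eq_eq, Prod.mk.injEq] at h ⊢
    obtain ⟨h, rfl, rfl⟩ := h
    obtain ⟨-, ⟨hx, -⟩, ⟨hy, -⟩, hxy⟩ := hq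
    obtain ⟨-, ⟨hx', -⟩, ⟨hy', -⟩, -⟩ := hq'
    refine ⟨?_, rfl, rfl⟩
    have := congrArg (fun A => insert x (insert y A)) h
    simpa only [Finset.insert_erase (Finset.mem_erase.mpr ⟨hxy.symm, hy⟩),
      Finset.insert_erase (Finset.mem_erase.mpr ⟨hxy.symm, hy'⟩), Finset.insert_erase hx,
      Finset.insert_erase hx'] using this
  · rw [Finset.card_sigma]
    refine (Finset.sum_le_card_nsmul _ _ _ fun A _ => hlink A).trans (le_of_eq ?_)
    rw [Finset.card_powersetCard, Finset.card_univ, Fintype.card_fin, smul_eq_mul]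

/-- The quadratic inequality for the average degree of the upper layer in `K`. It follows from the bound
on the number of pairs of removable elements by the Cauchy–Schwarz inequality. -/
theorem sq_density_le {K : SimpleGraph {s : Finset (Fin n) // s.card = k ∨ s.card = k + 1}}
    (hK : K ≤ doubledJohnson n k) (hk : 1 ≤ k) (hkn : k + 1 ≤ n) {m : ℕ} (hm : 3 ≤ m)
    (hfree : (cycleGraph (2 * m)).Free K) :
    ((numEdges K : ℝ) / n.choose (k + 1)) ^ 2 ≤ (numEdges K : ℝ) / n.choose (k + 1) +
      2 * extremalNumber n (cycleGraph m) * (k * (k + 1)) /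
        (((n : ℝ) - k + 1) * ((n : ℝ) - k)) := by
  have hM : (0 : ℝ) < n.choose (k + 1) := by exact_mod_cast Nat.choose_pos hkn
  have hkn' : (k : ℝ) + 1 ≤ n := by exact_mod_cast hkn
  have hd : (0 : ℝ) < (n : ℝ) - k := by linarith
  have hchoose : (n.choose (k + 1) : ℝ) * (k * (k + 1)) =
      n.choose (k - 1) * (((n : ℝ) - k + 1) * ((n : ℝ) - k)) := by
    obtain ⟨j, rfl⟩ : ∃ j, k = j + 1 := ⟨k - 1, by omega⟩
    have h1 : (n.choose (j + 1 + 1) : ℝ) * ((j + 1 : ℕ) + 1) =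
        n.choose (j + 1) * ((n : ℝ) - (j + 1 : ℕ)) := by
      rw [← Nat.cast_sub (by omega)]
      exact_mod_cast Nat.choose_succ_right_eq n (j + 1)
    have h2 : (n.choose (j + 1) : ℝ) * (j + 1) = n.choose j * ((n : ℝ) - j) := by
      rw [← Nat.cast_sub (by omega)]
      exact_mod_cast Nat.choose_succ_right_eq n j
    rw [Nat.add_sub_cancel]
    push_cast at h1 ⊢
    linear_combination (j + 1 : ℝ) * h1 + ((n : ℝ) - (j + 1)) * h2
  have hsum := sum_card_offDiag_removable_le hk hm hfree
  have hcs := sq_sum_le_card_mul_sum_sq (s := Finset.powersetCard (k + 1) Finset.univ)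
    (f := fun t => ((removable K t).card : ℝ))
  rw [Finset.card_powersetCard, Finset.card_univ, Fintype.card_fin, ← Nat.cast_sum,
    ← numEdges_eq_sum_card_removable hK] at hcs
  have hsq : ∑ t ∈ Finset.powersetCard (k + 1) Finset.univ, ((removable K t).card : ℝ) ^ 2 ≤
      numEdges K + n.choose (k - 1) * (2 * extremalNumber n (cycleGraph m)) := by
    have h1 : ∑ t ∈ Finset.powersetCard (k + 1) Finset.univ, (removable K t).card ^ 2 =
        ∑ t ∈ Finset.powersetCard (k + 1) Finset.univ, (removable K t).card +
        ∑ t ∈ Finset.powersetCard (k + 1) Finset.univ, (removable K t).offDiag.card := by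
      rw [← Finset.sum_add_distrib]
      refine Finset.sum_congr rfl fun t _ => ?_
      rw [Finset.offDiag_card, sq, Nat.add_sub_cancel' (Nat.le_mul_self _)]
    rw [← numEdges_eq_sum_card_removable hK] at h1
    exact_mod_cast h1.le.trans (Nat.add_le_add_left hsum _)
  set M : ℝ := (n.choose (k + 1) : ℝ)
  have hq : (n.choose (k - 1) : ℝ) = M * (k * (k + 1)) / (((n : ℝ) - k + 1) * ((n : ℝ) - k)) := by
    rw [hchoose, mul_div_cancel_right₀]
    positivity
  have h1 := hcs.trans (mul_le_mul_of_nonneg_left hsq hM.le)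
  rw [hq] at h1
  have h2 : (numEdges K : ℝ) / M + 2 * extremalNumber n (cycleGraph m) * (k * (k + 1)) /
        (((n : ℝ) - k + 1) * ((n : ℝ) - k)) = M * (numEdges K + M * (k * (k + 1)) /
        (((n : ℝ) - k + 1) * ((n : ℝ) - k)) * (2 * extremalNumber n (cycleGraph m))) / M ^ 2 := by
    field_simp
  rw [h2, div_pow]
  gcongr

/-- It suffices to bound the solutions `δ` of the quadratic inequality `sq_density_le`, as the upper
layer of the whole doubled Johnson graph has degree `k + 1`. -/
theorem turanNumber_le_of_root {m : ℕ} (hk : 1 ≤ k) (hkn : k + 1 ≤ n) (hm : 3 ≤ m) {ρ : ℝ}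
    (hρ : ∀ δ : ℝ, δ ^ 2 ≤ δ + 2 * extremalNumber n (cycleGraph m) * (k * (k + 1)) /
        (((n : ℝ) - k + 1) * ((n : ℝ) - k)) → δ ≤ ρ * (k + 1)) :
    (turanNumber (doubledJohnson n k) (cycleGraph (2 * m)) : ℝ) ≤
      ρ * numEdges (doubledJohnson n k) := by
  have : Nonempty (Fin (2 * m)) := ⟨⟨0, by omega⟩⟩
  obtain ⟨G', hfree, hG'⟩ := (turanNumber_isGreatest (doubledJohnson n k) (cycleGraph (2 * m))).1
  have hM : (0 : ℝ) < n.choose (k + 1) := by exact_mod_cast Nat.choose_pos hkn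
  rw [← numEdges_spanningCoe] at hG'
  have h := hρ _ (sq_density_le G'.spanningCoe_le hk hkn hm fun hc =>
    hfree (Subgraph.isContained_coe_of_spanningCoe (exists_cycleGraph_adj (by omega)) hc))
  rw [← hG', numEdges_doubledJohnson]
  rw [div_le_iff₀ hM] at h
  push_cast
  linarith

end DoubledJohnson

/-! ### Bounds on the extremal numbers -/

/-- With the Bondy–Simonovits bound the quadratic inequality reads `δ ^ 2 ≤ δ + Z ^ 2`, hence
`δ ≤ 1 + Z`, and `1 ≤ (k + 1) / √(k + 1)`. The ground set has `n ≤ 2 * (n - k)` elements, which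
turns the constant `80 * l` of that bound into `2 * 4 * 80 * l = 640 * l`. -/
theorem turanNumber_doubledJohnson_four_mul_le {l k n : ℕ} (hl : 2 ≤ l) (hk : 1 ≤ k)
    (hn : 2 * k + 1 ≤ n) :
    (turanNumber (doubledJohnson n k) (cycleGraph (4 * l)) : ℝ) ≤
      (Real.sqrt (640 * l) * ((n : ℝ) - (k : ℝ)) ^ (-(1 / 2 : ℝ) + 1 / (2 * (l : ℝ)))
        + 1 / Real.sqrt ((k : ℝ) + 1)) * (numEdges (doubledJohnson n k) : ℝ) := by
  rw [show 4 * l = 2 * (2 * l) by ring]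
  refine turanNumber_le_of_root hk (by omega) (by omega) fun δ hδ => ?_
  have hl' : (2 : ℝ) ≤ l := by exact_mod_cast hl
  have hk' : (1 : ℝ) ≤ k := by exact_mod_cast hk
  have hn' : 2 * (k : ℝ) + 1 ≤ n := by exact_mod_cast hn
  set d : ℝ := (n : ℝ) - k with hd
  have hd0 : 0 < d := by linarith
  set z : ℝ := d ^ (-(1 / 2 : ℝ) + 1 / (2 * (l : ℝ))) with hz
  have hz0 : 0 ≤ z := Real.rpow_nonneg hd0.le _
  have hzsq : d ^ (1 + 1 / (l : ℝ)) = z ^ 2 * d ^ 2 := by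
    rw [hz, ← Real.rpow_natCast, ← Real.rpow_natCast, ← Real.rpow_mul hd0.le,
      ← Real.rpow_add hd0]
    congr 1
    push_cast
    field_simp
    ring
  have hl1 : 1 / (l : ℝ) ≤ 1 := by
    rw [div_le_one (by linarith)]
    linarith
  have hX : (extremalNumber n (cycleGraph (2 * l)) : ℝ) ≤ 320 * l * (z ^ 2 * d ^ 2) := by
    refine (extremalNumber_cycleGraph_two_mul_le (by omega) n).trans ?_
    have h1 : (n : ℝ) ^ (1 + 1 / (l : ℝ)) ≤ 4 * (z ^ 2 * d ^ 2) := by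
      calc (n : ℝ) ^ (1 + 1 / (l : ℝ)) ≤ (2 * d) ^ (1 + 1 / (l : ℝ)) :=
            Real.rpow_le_rpow (by positivity) (by linarith) (by positivity)
        _ = 2 ^ (1 + 1 / (l : ℝ)) * (z ^ 2 * d ^ 2) := by
            rw [Real.mul_rpow (by norm_num) hd0.le, hzsq]
        _ ≤ 2 ^ (2 : ℝ) * (z ^ 2 * d ^ 2) := by
            gcongr
            · norm_num
            · linarith
        _ = 4 * (z ^ 2 * d ^ 2) := by norm_num
    calc 80 * l * (n : ℝ) ^ (1 + 1 / (l : ℝ)) ≤ 80 * l * (4 * (z ^ 2 * d ^ 2)) := by gcongr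
      _ = 320 * l * (z ^ 2 * d ^ 2) := by ring
  set Z : ℝ := Real.sqrt (640 * l) * z * (k + 1) with hZ
  have hZ0 : 0 ≤ Z := by positivity
  have hZsq : Z ^ 2 = 640 * l * z ^ 2 * (k + 1) ^ 2 := by
    rw [hZ, mul_pow, mul_pow, Real.sq_sqrt (by positivity)]
  have hY : 2 * (extremalNumber n (cycleGraph (2 * l)) : ℝ) * (k * (k + 1)) / ((d + 1) * d) ≤
      Z ^ 2 := by
    rw [div_le_iff₀ (by positivity), hZsq]
    calc 2 * (extremalNumber n (cycleGraph (2 * l)) : ℝ) * (k * (k + 1))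
        ≤ 2 * (320 * l * (z ^ 2 * d ^ 2)) * ((k + 1) * (k + 1)) := by
          gcongr
          linarith
      _ = 640 * l * z ^ 2 * (k + 1) ^ 2 * (d * d) := by ring
      _ ≤ 640 * l * z ^ 2 * (k + 1) ^ 2 * ((d + 1) * d) := by
          gcongr
          linarith
  have hδZ : δ ≤ 1 + Z := by
    by_contra! hlt
    nlinarith
  have hsqrt : (1 : ℝ) ≤ 1 / Real.sqrt ((k : ℝ) + 1) * (k + 1) := by
    rw [one_div, inv_mul_eq_div, Real.div_sqrt, Real.one_le_sqrt]
    linarith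
  calc δ ≤ 1 + Z := hδZ
    _ ≤ 1 / Real.sqrt ((k : ℝ) + 1) * (k + 1) + Z := by linarith
    _ = _ := by rw [hZ]; ring

theorem tendsto_extremalNumber_div {W : Type*} (H : SimpleGraph W) (k : ℕ) :
    Tendsto (fun n : ℕ => 2 * (extremalNumber n H : ℝ) * (k * (k + 1)) /
      (((n : ℝ) - k + 1) * ((n : ℝ) - k))) atTop (𝓝 (turanDensity H * (k * (k + 1)))) := by
  have h1 := ((tendsto_turanDensity H).mul_const ((k : ℝ) * (k + 1))).mul
    ((tendsto_natCast_div_sub 0 (-(k : ℝ) + 1)).mul (tendsto_natCast_div_sub (-1) (-(k : ℝ))))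
  rw [mul_one, mul_one] at h1
  refine h1.congr' ?_
  filter_upwards [eventually_ge_atTop (k + 2)] with n hn
  have hn' : (k : ℝ) + 2 ≤ n := by exact_mod_cast hn
  have hk : (0 : ℝ) ≤ k := by positivity
  have e1 : (n : ℝ) - 1 ≠ 0 := by linarith
  have e2 : (n : ℝ) - k ≠ 0 := by linarith
  have e3 : (n : ℝ) - k + 1 ≠ 0 := by linarith
  have e4 : (n : ℝ) ≠ 0 := by linarith
  rw [Nat.cast_choose_two, add_zero, show (n : ℝ) + (-k + 1) = n - k + 1 by ring,
    ← sub_eq_add_neg, ← sub_eq_add_neg]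
  field_simp

/-- The extremal number of an odd cycle is at most `(1 / 4 + o(1)) * n ^ 2`, so that the quadratic
inequality becomes `(δ - 1 / 2) ^ 2 ≤ 1 / 4 + k * (k + 1) / 2 + o(1)`, where the main term is at most
`(k + 1) ^ 2 / 2`. -/
theorem exists_tendsto_turanNumber_doubledJohnson_le {k l : ℕ} (hk : 1 ≤ k) (hl : 1 ≤ l) :
    ∃ f : ℕ → ℝ, Tendsto f atTop (𝓝 0) ∧ ∀ n : ℕ, 2 * k + 1 ≤ n →
      (turanNumber (doubledJohnson n k) (cycleGraph (4 * l + 2)) : ℝ) ≤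
        (1 / (2 * ((k : ℝ) + 1)) + Real.sqrt 2 / 2 + f n)
          * (numEdges (doubledJohnson n k) : ℝ) := by
  let H := cycleGraph (2 * l + 1)
  have hπ : turanDensity H ≤ 1 / 2 := by
    refine turanDensity_le_half (cycleGraph_odd_isContained_completeEquipartiteGraph hl) ?_
    intro hbot
    obtain ⟨w, hw⟩ := exists_cycleGraph_adj (show 2 ≤ 2 * l + 1 by omega) ⟨0, by omega⟩
    have hw' : H.Adj ⟨0, by omega⟩ w := hw
    rw [hbot] at hw'
    exact hw'
  have hk' : (1 : ℝ) ≤ k := by exact_mod_cast hk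
  let g : ℕ → ℝ := fun n => 2 * (extremalNumber n H : ℝ) * (k * (k + 1)) /
      (((n : ℝ) - k + 1) * ((n : ℝ) - k))
  have hg : Tendsto g atTop (𝓝 (turanDensity H * (k * (k + 1)))) := tendsto_extremalNumber_div H k
  refine ⟨fun n => max 0 (Real.sqrt (1 / 4 + g n) / (k + 1) - Real.sqrt 2 / 2), ?_, fun n hn => ?_⟩
  · have h1 : Tendsto (fun n => max 0 (Real.sqrt (1 / 4 + g n) / (k + 1) - Real.sqrt 2 / 2)) atTop
        (𝓝 (max 0 (Real.sqrt (1 / 4 + turanDensity H * (k * (k + 1))) / (k + 1)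
          - Real.sqrt 2 / 2))) :=
      tendsto_const_nhds.max ((((hg.const_add _).sqrt).div_const _).sub_const _)
    rwa [max_eq_left] at h1
    rw [sub_nonpos, div_le_iff₀ (by positivity)]
    refine Real.sqrt_le_iff.mpr ⟨by positivity, ?_⟩
    rw [mul_pow, div_pow, Real.sq_sqrt (by norm_num)]
    have : turanDensity H * ((k : ℝ) * (k + 1)) ≤ 1 / 2 * (k * (k + 1)) := by gcongr
    nlinarith
  · rw [show 4 * l + 2 = 2 * (2 * l + 1) by ring]
    refine turanNumber_le_of_root hk (by omega) (by omega) fun δ hδ => ?_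
    have h1 : (δ - 1 / 2) ^ 2 ≤ 1 / 4 + g n := by
      have : δ ^ 2 ≤ δ + g n := hδ
      linarith [show (δ - 1 / 2) ^ 2 = δ ^ 2 - δ + 1 / 4 by ring]
    have h2 : δ - 1 / 2 ≤ Real.sqrt (1 / 4 + g n) := Real.le_sqrt_of_sq_le h1
    have h3 := le_max_right 0 (Real.sqrt (1 / 4 + g n) / ((k : ℝ) + 1) - Real.sqrt 2 / 2)
    calc δ ≤ 1 / 2 + Real.sqrt (1 / 4 + g n) := by linarith
      _ = (1 / (2 * ((k : ℝ) + 1)) + Real.sqrt 2 / 2 +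
          (Real.sqrt (1 / 4 + g n) / (k + 1) - Real.sqrt 2 / 2)) * (k + 1) := by
            field_simp
            ring
      _ ≤ _ := by gcongr

theorem theorem1p1 :
    (∀ l : ℕ, 2 ≤ l → ∃ c : ℝ, ∀ k n : ℕ, 1 ≤ k → 2 * k + 1 ≤ n →
      (turanNumber (doubledJohnson n k) (SimpleGraph.cycleGraph (4 * l)) : ℝ) ≤
        (c * ((n : ℝ) - (k : ℝ)) ^ (-(1 / 2 : ℝ) + 1 / (2 * (l : ℝ)))
          + 1 / Real.sqrt ((k : ℝ) + 1)) * (numEdges (doubledJohnson n k) : ℝ)) ∧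
    (∀ k l : ℕ, 1 ≤ k → 1 ≤ l → ∃ f : ℕ → ℝ, Tendsto f atTop (𝓝 0) ∧
      ∀ n : ℕ, 2 * k + 1 ≤ n →
        (turanNumber (doubledJohnson n k) (SimpleGraph.cycleGraph (4 * l + 2)) : ℝ) ≤
          (1 / (2 * ((k : ℝ) + 1)) + Real.sqrt 2 / 2 + f n)
            * (numEdges (doubledJohnson n k) : ℝ)) :=
  ⟨fun l hl => ⟨Real.sqrt (640 * l), fun _ _ hk hn =>
    turanNumber_doubledJohnson_four_mul_le hl hk hn⟩,
   fun _ _ hk hl => exists_tendsto_turanNumber_doubledJohnson_le hk hl⟩
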